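/- Let $(R,\mathfrak m)$ be a commutative Artinian local ring with residue field $k=R/\mathfrak m$, let $\omega$ be a canonical module of $R$ (that is, an injective hull of $k$), and let $I$ be an ideal of $R$ with $I\neq\mathfrak m$. For an $R$-module $X$ write $\operatorname{Soc}(X)=\{x\in X:\mathfrak m x=0\}$ and $X^{\dagger}=\operatorname{Hom}_R(X,\omega)$. If $X$ is finitely generated, let $X_i$ denote the $i$-th syzygy of $X$ in a minimal free resolution of $X$ (so $X_0=X$). Call $X$ *$I$-free* if $X/IX$ is a free $R/I$-module. Let $M$ be a finitely generated $R$-module such that $$\operatorname{Soc}(M)=IM,\qquad \operatorname{Soc}(M^{\dagger})=IM^{\dagger},\qquad \mathfrak m IM=0=\mathfrak m IM^{\dagger}.$$ If for all $i\gg 0$ the syzygies $M_i$ and $(M^{\dagger})_i$ are both $I$-free and $\operatorname{Tor}^R_i(M,M^{\dagger})=0$, then $M$ or $M^{\dagger}$ is a free $R$-module. -/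

import Mathlib

open CategoryTheory Filter

universe u

/-- `M` is `I`-free: `M / IM` is a free `R / I`-module. -/
def IFree {R : Type u} [CommRing R] (I : Ideal R) (M : Type u) [AddCommGroup M] [Module R M] :
    Prop :=
  Module.Free (R ⧸ I) (M ⧸ (I • ⊤ : Submodule R M))

/-- The socle of a module over a local ring: the elements annihilated by the maximal ideal. -/
def socle (R : Type u) [CommRing R] [IsLocalRing R] (M : Type u) [AddCommGroup M] [Module R M] :
    Submodule R M :=
  Submodule.torsionBySet R M (IsLocalRing.maximalIdeal R : Set R)

/-- `ω` is a canonical module of the Artinian local ring `R`, that is, an injective hull of the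
residue field: `ω` is injective and is an essential extension of a copy of the residue field. -/
structure IsCanonicalModule (R : Type u) [CommRing R] [IsLocalRing R]
    (ω : Type u) [AddCommGroup ω] [Module R ω] : Prop where
  injective : Module.Injective R ω
  essential : ∃ f : IsLocalRing.ResidueField R →ₗ[R] ω, Function.Injective f ∧
    ∀ N : Submodule R ω, N ≠ ⊥ → N ⊓ LinearMap.range f ≠ ⊥

/-- A minimal free resolution
`⋯ → R ^ (rank 2) → R ^ (rank 1) → R ^ (rank 0) → M → 0` of a module over a local ring. -/
structure MinimalFreeResolution (R : Type u) [CommRing R] [IsLocalRing R]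
    (M : Type u) [AddCommGroup M] [Module R M] where
  rank : ℕ → ℕ
  d : ∀ i : ℕ, (Fin (rank (i + 1)) → R) →ₗ[R] (Fin (rank i) → R)
  aug : (Fin (rank 0) → R) →ₗ[R] M
  aug_surjective : Function.Surjective aug
  exact_zero : LinearMap.range (d 0) = LinearMap.ker aug
  exact_succ : ∀ i : ℕ, LinearMap.range (d (i + 1)) = LinearMap.ker (d i)
  minimal : ∀ i : ℕ, LinearMap.range (d i) ≤
    IsLocalRing.maximalIdeal R • (⊤ : Submodule R (Fin (rank i) → R))

namespace MinimalFreeResolution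

/-- The `i`-th syzygy of `M` in a minimal free resolution: the `0`-th one is `M` itself, the
`(i + 1)`-st one is the image of `R ^ (rank (i + 1)) → R ^ (rank i)`. -/
def syzygy {R : Type u} [CommRing R] [IsLocalRing R] {M : Type u} [AddCommGroup M] [Module R M]
    (F : MinimalFreeResolution R M) : ℕ → ModuleCat.{u} R
  | 0 => ModuleCat.of R M
  | i + 1 => ModuleCat.of R (LinearMap.range (F.d i))

/-- Minimal free covers exist. -/
theorem exists_cover (R : Type u) [CommRing R] [IsLocalRing R]
    (M : Type u) [AddCommGroup M] [Module R M] [Module.Finite R M] :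
    ∃ (n : ℕ) (f : (Fin n → R) →ₗ[R] M), Function.Surjective f ∧
      LinearMap.ker f ≤ IsLocalRing.maximalIdeal R • (⊤ : Submodule R (Fin n → R)) := by
  let k := IsLocalRing.ResidueField R
  let b := Module.finBasis k (TensorProduct R k M)
  have hs : Function.Surjective (TensorProduct.mk R k M 1) :=
    TensorProduct.mk_surjective R M k IsLocalRing.residue_surjective
  choose x hx using fun i => hs (b i)
  refine ⟨_, Fintype.linearCombination R x, ?_, ?_⟩
  · rw [← LinearMap.range_eq_top, Fintype.range_linearCombination]
    exact IsLocalRing.span_eq_top_of_tmul_eq_basis x b hx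
  · intro a ha
    have h0 : ∑ i, (IsLocalRing.residue R (a i)) • b i = 0 := by
      have h1 := congrArg (TensorProduct.mk R k M 1) (LinearMap.mem_ker.1 ha)
      rw [Fintype.linearCombination_apply, map_sum, map_zero] at h1
      rw [← h1]
      refine Finset.sum_congr rfl fun i _ => ?_
      rw [map_smul, hx]
      rfl
    have h2 := Fintype.linearIndependent_iff.1 b.linearIndependent _ h0
    rw [pi_eq_sum_univ a]
    refine Submodule.sum_mem _ fun i _ => Submodule.smul_mem_smul ?_ trivial
    exact (IsLocalRing.residue_eq_zero_iff _).1 (h2 i)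

/-- Finite modules over Noetherian local rings have minimal free resolutions. -/
theorem nonempty (R : Type u) [CommRing R] [IsLocalRing R] [IsNoetherianRing R]
    (M : Type u) [AddCommGroup M] [Module R M] [Module.Finite R M] :
    Nonempty (MinimalFreeResolution R M) := by
  obtain ⟨n, f, hf, hfm⟩ := exists_cover R M
  have step : ∀ p : (Σ n : ℕ, Submodule R (Fin n → R)),
      ∃ (m : ℕ) (g : (Fin m → R) →ₗ[R] (Fin p.1 → R)), LinearMap.range g = p.2 ∧
        LinearMap.ker g ≤ IsLocalRing.maximalIdeal R • (⊤ : Submodule R (Fin m → R)) := by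
    intro p
    obtain ⟨m, g, hg, hgm⟩ := exists_cover R p.2
    refine ⟨m, p.2.subtype ∘ₗ g, ?_, ?_⟩
    · rw [LinearMap.range_comp, LinearMap.range_eq_top.2 hg, Submodule.map_top,
        Submodule.range_subtype]
    · rwa [LinearMap.ker_comp_of_ker_eq_bot _ p.2.ker_subtype]
  choose m g hg hgm using step
  let S : ℕ → Σ n : ℕ, Submodule R (Fin n → R) := fun i =>
    Nat.rec ⟨n, LinearMap.ker f⟩ (fun _ p => ⟨m p, LinearMap.ker (g p)⟩) i
  refine ⟨⟨fun i => (S i).1, fun i => g (S i), f, hf, hg (S 0), fun i => hg (S (i + 1)), ?_⟩⟩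
  intro i
  refine (hg (S i)).le.trans ?_
  cases i with
  | zero => exact hfm
  | succ i => exact hgm (S i)

end MinimalFreeResolution

/-! Write `N` for the dual of `M` and suppose neither is free, so no syzygy of either vanishes. Let
`S` be a high syzygy of `M`, inside a free module `P`. Vanishing of Tor makes `S ⊗ N → P ⊗ N`
injective and, for a minimal free resolution `G` of `N`, makes `S ⊗ G` a resolution of `S ⊗ N`. The
syzygy before `S` is `I`-free, which forces `S ≤ I P`; since `𝔪 I N = 0`, the ideal `𝔪` kills `S ⊗
N`.

Fix `x ∈ 𝔪` and `a ∈ S`. The chain map `x (a ⊗ -) : G → S ⊗ G` induces zero on `H₀`, so it is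
null-homotopic. In high degrees the differentials of `G` have entries in `I`, again by `I`-freeness,
and the homotopy formula gives `x a ∈ I S`. Thus `𝔪 S ≤ I S`. For `I` proper, `S / I S` is a nonzero
free `R / I`-module, so `𝔪 ≤ I` and `I = 𝔪`, which is excluded. For `I = R` the same argument with
`x = 1` and `𝔪` in place of `I` gives `S = 𝔪 S`, contradicting Nakayama. -/

/-! ### Diagram chases with tensored exact sequences -/

open TensorProduct in
theorem LinearMap.lTensor_rTensor_apply {R B C X Z : Type*} [CommRing R] [AddCommGroup B]
    [AddCommGroup C] [AddCommGroup X] [AddCommGroup Z] [Module R B] [Module R C] [Module R X]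
    [Module R Z] (g : B →ₗ[R] C) (f : X →ₗ[R] Z) (t : B ⊗[R] X) :
    f.lTensor C (g.rTensor X t) = g.rTensor Z (f.lTensor B t) := by
  rw [← LinearMap.comp_apply, ← LinearMap.comp_apply, LinearMap.lTensor_comp_rTensor,
    LinearMap.rTensor_comp_lTensor]

open TensorProduct in
/-- For a short exact sequence `0 → A' → P → A → 0` and a complex `X₂ → X₁ → X₀ → Y`: exactness
after tensoring with `P` and `A` in adjacent spots yields a lifting property for `A'`. -/
theorem LinearMap.exists_lTensor_eq_of_exact {R : Type*} [CommRing R]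
    {A' P A X₂ X₁ X₀ Y : Type*}
    [AddCommGroup A'] [AddCommGroup P] [AddCommGroup A] [AddCommGroup X₂] [AddCommGroup X₁]
    [AddCommGroup X₀] [AddCommGroup Y] [Module R A'] [Module R P] [Module R A] [Module R X₂]
    [Module R X₁] [Module R X₀] [Module R Y] [Module.Flat R X₀]
    {ι : A' →ₗ[R] P} {π : P →ₗ[R] A} (hι : Function.Injective ι) (hπ : Function.Surjective π)
    (hex : Function.Exact ι π)
    {f₂ : X₂ →ₗ[R] X₁} {f₁ : X₁ →ₗ[R] X₀} {f₀ : X₀ →ₗ[R] Y} (hf : f₁ ∘ₗ f₂ = 0)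
    (hP : Function.Exact (f₁.lTensor P) (f₀.lTensor P))
    (hA : Function.Exact (f₂.lTensor A) (f₁.lTensor A))
    (y : A' ⊗[R] X₀) (hy : f₀.lTensor P (ι.rTensor X₀ y) = 0) :
    ∃ u, f₁.lTensor A' u = y := by
  have zero (X : Type _) [AddCommGroup X] [Module R X] (t : A' ⊗[R] X) :
      π.rTensor X (ι.rTensor X t) = 0 := by
    rw [← LinearMap.comp_apply, ← LinearMap.rTensor_comp, hex.linearMap_comp_eq_zero]
    simp
  -- Lift over `P`, then correct the lift by a boundary so that it dies in `A ⊗ X₁` and hence comes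
  -- from `A' ⊗ X₁`.
  obtain ⟨w, hw⟩ := (hP _).1 hy
  obtain ⟨v, hv⟩ := (hA (π.rTensor X₁ w)).1 (by rw [LinearMap.lTensor_rTensor_apply, hw, zero])
  obtain ⟨v', rfl⟩ := LinearMap.rTensor_surjective X₂ hπ v
  obtain ⟨u, hu⟩ := ((rTensor_exact X₁ hex hπ) (w - f₂.lTensor P v')).1 (by
    rw [map_sub, ← LinearMap.lTensor_rTensor_apply, hv, sub_self])
  refine ⟨u, Module.Flat.rTensor_preserves_injective_linearMap (M := X₀) ι hι ?_⟩
  rw [← LinearMap.lTensor_rTensor_apply, hu, map_sub, hw, ← LinearMap.comp_apply, ← LinearMap.lTensor_comp, hf]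
  simp

/-! ### Modules free modulo `I` -/

/-- A surjection from a finite free module with kernel in `𝔪 • ⊤` has kernel in `I • ⊤` if its
target is free modulo `I`. -/
theorem IFree.ker_le {R : Type u} [CommRing R] [IsLocalRing R] [IsNoetherianRing R]
    {I : Ideal R} {S : Type u} [AddCommGroup S] [Module R S] (hS : IFree I S)
    {P : Type*} [AddCommGroup P] [Module R P] [Module.Finite R P]
    {f : P →ₗ[R] S} (hf : Function.Surjective f)
    (hker : LinearMap.ker f ≤ IsLocalRing.maximalIdeal R • (⊤ : Submodule R P)) :
    LinearMap.ker f ≤ I • (⊤ : Submodule R P) := by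
  by_cases hI : I = ⊤
  · simp [hI]
  have hIm := IsLocalRing.le_maximalIdeal hI
  unfold IFree at hS
  have hle : I • (⊤ : Submodule R P) ≤ (I • (⊤ : Submodule R S)).comap f := by
    rw [← Submodule.map_le_iff_le_comap, Submodule.map_smul'']
    exact Submodule.smul_mono le_rfl le_top
  let g : (P ⧸ (I • ⊤ : Submodule R P)) →ₗ[R] (S ⧸ (I • ⊤ : Submodule R S)) :=
    Submodule.mapQ _ _ f hle
  have hg : Function.Surjective g := by
    intro s
    obtain ⟨s, rfl⟩ := Submodule.Quotient.mk_surjective _ s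
    obtain ⟨p, rfl⟩ := hf s
    exact ⟨Submodule.Quotient.mk p, rfl⟩
  let g' : (P ⧸ (I • ⊤ : Submodule R P)) →ₗ[R ⧸ I] (S ⧸ (I • ⊤ : Submodule R S)) :=
    { g with
      map_smul' := by
        intro r x
        obtain ⟨r, rfl⟩ := Ideal.Quotient.mk_surjective r
        exact g.map_smul r x }
  -- Freeness over `R ⧸ I` splits the reduction of `f` modulo `I`.
  obtain ⟨s', hs'⟩ := Module.projective_lifting_property g' LinearMap.id hg
  let s : (S ⧸ (I • ⊤ : Submodule R S)) →ₗ[R] (P ⧸ (I • ⊤ : Submodule R P)) :=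
    { s' with
      map_smul' := by
        intro r x
        exact s'.map_smul (Ideal.Quotient.mk I r) x }
  have hs : ∀ x, g (s x) = x := fun x => LinearMap.congr_fun hs' x
  -- If `f p ∈ I S = f (I P)`, then `p ∈ I P + ker f ≤ 𝔪 P`.
  have hgm : LinearMap.ker g ≤ IsLocalRing.maximalIdeal R • ⊤ := by
    intro q hq
    obtain ⟨p, rfl⟩ := Submodule.Quotient.mk_surjective _ q
    have h1 : f p ∈ I • (⊤ : Submodule R S) := by
      rw [LinearMap.mem_ker] at hq
      exact (Submodule.Quotient.mk_eq_zero _).1 hq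
    rw [← LinearMap.range_eq_top.2 hf, LinearMap.range_eq_map, ← Submodule.map_smul''] at h1
    obtain ⟨p', hp', hpp⟩ := h1
    have h2 : p ∈ IsLocalRing.maximalIdeal R • (⊤ : Submodule R P) := by
      have h3 : p - p' ∈ LinearMap.ker f := by simp [hpp]
      have := add_mem (hker h3) (Submodule.smul_mono_left hIm hp')
      simpa using this
    have h4 := Submodule.mem_map_of_mem (f := Submodule.mkQ (I • ⊤ : Submodule R P)) h2
    rw [Submodule.map_smul''] at h4
    exact Submodule.smul_mono le_rfl le_top h4
  -- The projection `id - s ∘ g` onto `ker g` turns the bound by `𝔪 • ⊤` into `ker g ≤ 𝔪 • ker g`;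
  -- Nakayama applies.
  have hbot : LinearMap.ker g = ⊥ := by
    have hp : ∀ x, x - s (g x) ∈ LinearMap.ker g := fun x => by simp [hs]
    refine Submodule.eq_bot_of_le_smul_of_le_jacobson_bot (IsLocalRing.maximalIdeal R) _
      (IsNoetherian.noetherian _) ?_ (IsLocalRing.maximalIdeal_le_jacobson _)
    intro q hq
    have h1 := Submodule.mem_map_of_mem (f := (LinearMap.id - s ∘ₗ g : _ →ₗ[R] _)) (hgm hq)
    rw [Submodule.map_smul''] at h1
    have h2 : (LinearMap.id - s ∘ₗ g : _ →ₗ[R] _) q = q := by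
      simp [LinearMap.mem_ker.1 hq]
    rw [h2] at h1
    refine Submodule.smul_mono le_rfl ?_ h1
    rintro _ ⟨x, -, rfl⟩
    exact hp x
  intro p hp
  have h1 : (Submodule.Quotient.mk p : P ⧸ (I • ⊤ : Submodule R P)) ∈ LinearMap.ker g := by
    rw [LinearMap.mem_ker] at hp ⊢
    change Submodule.Quotient.mk (f p) = 0
    rw [hp, Submodule.Quotient.mk_zero]
  rw [hbot, Submodule.mem_bot] at h1
  exact (Submodule.Quotient.mk_eq_zero _).1 h1

/-- A nonzero finite `I`-free module has an element which is faithful modulo `I`. -/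
theorem IFree.exists_smul_mem_imp {R : Type u} [CommRing R] [IsLocalRing R] {I : Ideal R}
    (hI : I ≠ ⊤) {S : Type u} [AddCommGroup S] [Module R S] [Module.Finite R S] [Nontrivial S]
    (hS : IFree I S) :
    ∃ s : S, ∀ r : R, r • s ∈ I • (⊤ : Submodule R S) → r ∈ I := by
  unfold IFree at hS
  have hnt : Nontrivial (S ⧸ (I • ⊤ : Submodule R S)) := by
    rw [Submodule.Quotient.nontrivial_iff]
    intro h
    have := Submodule.eq_bot_of_le_smul_of_le_jacobson_bot I (⊤ : Submodule R S)
      Module.Finite.fg_top h.ge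
      ((IsLocalRing.le_maximalIdeal hI).trans (IsLocalRing.maximalIdeal_le_jacobson _))
    exact top_ne_bot this
  let b := Module.Free.chooseBasis (R ⧸ I) (S ⧸ (I • ⊤ : Submodule R S))
  obtain ⟨i⟩ := b.index_nonempty
  obtain ⟨s, hs⟩ := Submodule.Quotient.mk_surjective _ (b i)
  refine ⟨s, fun r hr => ?_⟩
  have h1 : (Ideal.Quotient.mk I r) • b i = 0 := by
    rw [← hs]
    exact (Submodule.Quotient.mk_eq_zero _).2 hr
  have h2 := congrArg (fun v => b.repr v i) h1
  simp only [map_smul] at h2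
  simpa [Ideal.Quotient.eq_zero_iff_mem, -Ideal.Quotient.mk_eq_mk] using h2

/-! ### Tor computed from a minimal free resolution -/

namespace MinimalFreeResolution
variable {R : Type u} [CommRing R] [IsLocalRing R] {M : Type u} [AddCommGroup M] [Module R M]

/-- The underlying chain complex of a minimal free resolution. -/
noncomputable def complex (F : MinimalFreeResolution R M) : ChainComplex (ModuleCat.{u} R) ℕ :=
  ChainComplex.of (fun i => ModuleCat.of R (Fin (F.rank i) → R)) (fun i => ModuleCat.ofHom (F.d i))
    (fun i => by
      ext1
      refine LinearMap.ext fun x => ?_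
      exact LinearMap.mem_ker.1 ((F.exact_succ i).le ⟨x, rfl⟩))

theorem complex_d (F : MinimalFreeResolution R M) (i : ℕ) :
    F.complex.d (i + 1) i = ModuleCat.ofHom (F.d i) :=
  ChainComplex.of_d (fun i => ModuleCat.of R (Fin (F.rank i) → R))
    (fun i => ModuleCat.ofHom (F.d i)) i

theorem complex_exactAt_succ (F : MinimalFreeResolution R M) (i : ℕ) :
    F.complex.ExactAt (i + 1) := by
  rw [HomologicalComplex.exactAt_iff' _ (i + 1 + 1) (i + 1) i (by simp) (by simp),
    ShortComplex.moduleCat_exact_iff_range_eq_ker]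
  dsimp [HomologicalComplex.sc', HomologicalComplex.shortComplexFunctor']
  rw [complex_d, complex_d]
  exact F.exact_succ i

/-- The augmentation of the underlying chain complex. -/
noncomputable def complexAug (F : MinimalFreeResolution R M) : F.complex.X 0 ⟶ ModuleCat.of R M :=
  ModuleCat.ofHom F.aug

theorem complex_d_comp_complexAug (F : MinimalFreeResolution R M) :
    F.complex.d 1 0 ≫ F.complexAug = 0 := by
  refine (congrArg (fun f => f ≫ F.complexAug) (F.complex_d 0)).trans ?_
  ext1
  refine LinearMap.ext fun x => ?_
  exact LinearMap.mem_ker.1 (F.exact_zero.le ⟨x, rfl⟩)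

/-- A minimal free resolution as a projective resolution in the category of modules. -/
noncomputable def projectiveResolution (F : MinimalFreeResolution R M) :
    ProjectiveResolution (ModuleCat.of R M) where
  complex := F.complex
  projective n := ModuleCat.projective_of_free (M := ModuleCat.of R (Fin (F.rank n) → R)) (Pi.basisFun R (Fin (F.rank n)))
  π := (ChainComplex.toSingle₀Equiv _ _).symm ⟨F.complexAug, F.complex_d_comp_complexAug⟩
  quasiIso := ⟨fun n => by
    cases n with
    | zero =>
      rw [ChainComplex.quasiIsoAt₀_iff, ShortComplex.quasiIso_iff_of_zeros']
      · constructor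
        · rw [ShortComplex.moduleCat_exact_iff_range_eq_ker]
          dsimp [HomologicalComplex.sc', HomologicalComplex.shortComplexFunctor']
          rw [ChainComplex.toSingle₀Equiv_symm_apply_f_zero]
          refine (congrArg (fun f => LinearMap.range f.hom) (F.complex_d 0)).trans ?_
          exact F.exact_zero
        · rw [ModuleCat.epi_iff_surjective]
          have h : ((F.complex.toSingle₀Equiv (ModuleCat.of R M)).symm ⟨F.complexAug,
              F.complex_d_comp_complexAug⟩).f 0 =
              F.complexAug := ChainComplex.toSingle₀Equiv_symm_apply_f_zero _ _
          exact (congrArg (fun f => Function.Surjective f.hom) h).mpr F.aug_surjective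
      all_goals rfl
    | succ n =>
      rw [quasiIsoAt_iff_exactAt']
      · exact F.complex_exactAt_succ n
      · apply ChainComplex.exactAt_succ_single_obj⟩

/-- Vanishing of `Tor` means exactness of the tensored minimal free resolution. -/
theorem exact_lTensor_of_isZero_tor (F : MinimalFreeResolution R M) (A : Type u) [AddCommGroup A]
    [Module R A] (i : ℕ)
    (h : Limits.IsZero (((Tor (ModuleCat.{u} R) (i + 1)).obj (ModuleCat.of R A)).obj
      (ModuleCat.of R M))) :
    Function.Exact ((F.d (i + 1)).lTensor A) ((F.d i).lTensor A) := by
  have h1 := h.of_iso (F.projectiveResolution.isoLeftDerivedObj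
    ((MonoidalCategory.tensoringLeft (ModuleCat.{u} R)).obj (ModuleCat.of R A)) (i + 1)).symm
  have h2 := (HomologicalComplex.exactAt_iff_isZero_homology _ _).2 h1
  rw [HomologicalComplex.exactAt_iff' _ (i + 1 + 1) (i + 1) i (by simp) (by simp),
    ShortComplex.moduleCat_exact_iff_range_eq_ker] at h2
  rw [LinearMap.exact_iff]
  have e (j : ℕ) : (((((MonoidalCategory.tensoringLeft (ModuleCat.{u} R)).obj
      (ModuleCat.of R A)).mapHomologicalComplex _).obj F.complex).d (j + 1) j).hom =
      (F.d j).lTensor A :=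
    congrArg (fun f => (MonoidalCategory.whiskerLeft (ModuleCat.of R A) f).hom) (F.complex_d j)
  have e1 := e (i + 1)
  have e2 := e i
  refine (((congrArg LinearMap.range e1).symm.trans h2).trans (congrArg LinearMap.ker e2)).symm

end MinimalFreeResolution

/-! ### Dimension shifting and null-homotopies -/

open TensorProduct

/-- A linear map with range in `I • ⊤` has range in `I • ⊤` after tensoring. -/
theorem LinearMap.lTensor_mem_smul_top {R A X Y : Type*} [CommRing R] [AddCommGroup A]
    [AddCommGroup X] [AddCommGroup Y] [Module R A] [Module R X] [Module R Y] {I : Ideal R}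
    {f : X →ₗ[R] Y} (hf : LinearMap.range f ≤ I • (⊤ : Submodule R Y)) (z : A ⊗[R] X) :
    f.lTensor A z ∈ I • (⊤ : Submodule R (A ⊗[R] Y)) := by
  induction z with
  | zero => simp
  | add x y hx hy => rw [map_add]; exact add_mem hx hy
  | tmul a x =>
    have h := Submodule.mem_map_of_mem (f := TensorProduct.mk R A Y a) (hf ⟨x, rfl⟩)
    rw [Submodule.map_smul''] at h
    exact Submodule.smul_mono le_rfl le_top h

namespace MinimalFreeResolution

variable {R : Type u} [CommRing R] [IsLocalRing R] {M : Type u} [AddCommGroup M] [Module R M]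

theorem d_comp_d (F : MinimalFreeResolution R M) (i : ℕ) : F.d i ∘ₗ F.d (i + 1) = 0 :=
  LinearMap.ext fun x => LinearMap.mem_ker.1 ((F.exact_succ i).le ⟨x, rfl⟩)

theorem exact_aug (F : MinimalFreeResolution R M) : Function.Exact (F.d 0) F.aug :=
  LinearMap.exact_iff.2 F.exact_zero.symm

theorem exact_d (F : MinimalFreeResolution R M) (i : ℕ) : Function.Exact (F.d (i + 1)) (F.d i) :=
  LinearMap.exact_iff.2 (F.exact_succ i).symm

theorem exact_subtype_aug (F : MinimalFreeResolution R M) :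
    Function.Exact (LinearMap.range (F.d 0)).subtype F.aug := by
  rw [LinearMap.exact_iff, Submodule.range_subtype, F.exact_zero]

theorem exact_subtype_rangeRestrict (F : MinimalFreeResolution R M) (i : ℕ) :
    Function.Exact (LinearMap.range (F.d (i + 1))).subtype (F.d i).rangeRestrict := by
  rw [LinearMap.exact_iff, Submodule.range_subtype, LinearMap.ker_rangeRestrict, F.exact_succ]

/-- Dimension shifting: exactness of `A ⊗ F` in degree `n + 2` passes to exactness of `A' ⊗ F` in
degree `n + 1`, if `A'` is the kernel of a surjection from a flat module to `A`. -/
theorem exact_lTensor_of_exact (F : MinimalFreeResolution R M) {A' P A : Type*}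
    [AddCommGroup A'] [AddCommGroup P] [AddCommGroup A] [Module R A'] [Module R P] [Module R A]
    [Module.Flat R P] {ι : A' →ₗ[R] P} {π : P →ₗ[R] A} (hι : Function.Injective ι)
    (hπ : Function.Surjective π) (hex : Function.Exact ι π) (n : ℕ)
    (h : Function.Exact ((F.d (n + 2)).lTensor A) ((F.d (n + 1)).lTensor A)) :
    Function.Exact ((F.d (n + 1)).lTensor A') ((F.d n).lTensor A') := by
  intro y
  constructor
  · intro hy
    refine LinearMap.exists_lTensor_eq_of_exact hι hπ hex (F.d_comp_d (n + 1))
      (Module.Flat.lTensor_exact P (F.exact_d n)) h y ?_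
    rw [LinearMap.lTensor_rTensor_apply, hy, map_zero]
  · rintro ⟨u, rfl⟩
    rw [← LinearMap.comp_apply, ← LinearMap.lTensor_comp, F.d_comp_d]
    simp

/-- The kernel of `A' ⊗ M → P ⊗ M` is `Tor₁(A, M)`; the hypothesis `h` is its vanishing. -/
theorem rTensor_injective_of_exact (F : MinimalFreeResolution R M) {A' P A : Type*}
    [AddCommGroup A'] [AddCommGroup P] [AddCommGroup A] [Module R A'] [Module R P] [Module R A]
    [Module.Flat R P] {ι : A' →ₗ[R] P} {π : P →ₗ[R] A} (hι : Function.Injective ι)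
    (hπ : Function.Surjective π) (hex : Function.Exact ι π)
    (h : Function.Exact ((F.d 1).lTensor A) ((F.d 0).lTensor A)) :
    Function.Injective (ι.rTensor M) := by
  rw [injective_iff_map_eq_zero]
  intro z hz
  obtain ⟨y, rfl⟩ := LinearMap.lTensor_surjective A' F.aug_surjective z
  obtain ⟨u, rfl⟩ := LinearMap.exists_lTensor_eq_of_exact hι hπ hex (F.d_comp_d 0)
    (Module.Flat.lTensor_exact P F.exact_aug) h y (by rw [LinearMap.lTensor_rTensor_apply, hz])
  rw [← LinearMap.comp_apply, ← LinearMap.lTensor_comp, F.exact_aug.linearMap_comp_eq_zero]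
  simp

/-- High syzygies are `Tor`-independent of `N` if `Tor` vanishes in high degrees. -/
theorem exact_lTensor_range {N : Type u} [AddCommGroup N] [Module R N]
    (F : MinimalFreeResolution R M) (G : MinimalFreeResolution R N) {n₀ : ℕ}
    (h : ∀ n, n₀ ≤ n → Function.Exact ((G.d (n + 1)).lTensor M) ((G.d n).lTensor M)) :
    ∀ j n : ℕ, n₀ ≤ j + n + 1 → Function.Exact
      ((G.d (n + 1)).lTensor (LinearMap.range (F.d j)))
      ((G.d n).lTensor (LinearMap.range (F.d j)))
  -- Each passage to a syzygy costs one degree: `Tor (n + 1)` of the `(j + 1)`-st syzygy is `Tor (n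
  -- + j + 2)` of `M`.
  | 0, n, hn => G.exact_lTensor_of_exact (Submodule.subtype_injective _) F.aug_surjective
      F.exact_subtype_aug n (h (n + 1) (by omega))
  | j + 1, n, hn => G.exact_lTensor_of_exact (Submodule.subtype_injective _)
      (F.d j).surjective_rangeRestrict (F.exact_subtype_rangeRestrict j) n
      (exact_lTensor_range F G h j (n + 1) (by omega))

/-- If a ring element `x` kills `A ⊗ N` and `A` is `Tor`-independent of `N`, then multiplication by
`x` on `A ⊗ G` is null-homotopic on every pure tensor `a ⊗ G`. -/
theorem exists_homotopy {N : Type u} [AddCommGroup N] [Module R N]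
    (G : MinimalFreeResolution R N) {A : Type u} [AddCommGroup A] [Module R A]
    (h : ∀ n, Function.Exact ((G.d (n + 1)).lTensor A) ((G.d n).lTensor A))
    {x : R} (hx : ∀ z : A ⊗[R] N, x • z = 0) (a : A) :
    ∀ n : ℕ, ∃ (ρ : (Fin (G.rank n) → R) →ₗ[R] A ⊗[R] (Fin (G.rank (n + 1)) → R))
      (ρ' : (Fin (G.rank (n + 1)) → R) →ₗ[R] A ⊗[R] (Fin (G.rank (n + 2)) → R)),
      (G.d (n + 1)).lTensor A ∘ₗ ρ' + ρ ∘ₗ G.d n =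
        x • TensorProduct.mk R A (Fin (G.rank (n + 1)) → R) a := by
  have nat (n : ℕ) : (G.d n).lTensor A ∘ₗ TensorProduct.mk R A _ a =
      TensorProduct.mk R A _ a ∘ₗ G.d n := LinearMap.ext fun _ => rfl
  have lift {n m k : ℕ} {f : (Fin m → R) →ₗ[R] (Fin k → R)} {C : Type u} [AddCommGroup C]
      [Module R C] {f' : A ⊗[R] (Fin k → R) →ₗ[R] C} (hf : Function.Exact (f.lTensor A) f')
      (g : (Fin n → R) →ₗ[R] A ⊗[R] (Fin k → R)) (hg : f' ∘ₗ g = 0) :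
      ∃ ρ, f.lTensor A ∘ₗ ρ = g := by
    choose v hv using fun i => (hf (g (Pi.basisFun R (Fin n) i))).1 (LinearMap.congr_fun hg _)
    refine ⟨(Pi.basisFun R (Fin n)).constr R v, (Pi.basisFun R (Fin n)).ext fun i => ?_⟩
    rw [LinearMap.comp_apply, Module.Basis.constr_basis, hv]
  have step (n : ℕ) (ρ : (Fin (G.rank n) → R) →ₗ[R] A ⊗[R] (Fin (G.rank (n + 1)) → R))
      (hρ : ((G.d n).lTensor A ∘ₗ ρ) ∘ₗ G.d n = x • TensorProduct.mk R A _ a ∘ₗ G.d n) :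
      ∃ ρ' : (Fin (G.rank (n + 1)) → R) →ₗ[R] A ⊗[R] (Fin (G.rank (n + 2)) → R),
        (G.d (n + 1)).lTensor A ∘ₗ ρ' + ρ ∘ₗ G.d n =
          x • TensorProduct.mk R A (Fin (G.rank (n + 1)) → R) a := by
    obtain ⟨ρ', h'⟩ := lift (h n) (x • TensorProduct.mk R A _ a - ρ ∘ₗ G.d n) (by
      rw [LinearMap.comp_sub, LinearMap.comp_smul, nat, ← LinearMap.comp_assoc, hρ, sub_self])
    exact ⟨ρ', by rw [h', sub_add_cancel]⟩
  intro n
  induction n with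
  | zero =>
    -- In degree zero `x (a ⊗ -)` is a boundary because its image in `A ⊗ N` is killed by `x`.
    obtain ⟨ρ, hρ⟩ := lift (lTensor_exact A G.exact_aug G.aug_surjective)
      (x • TensorProduct.mk R A _ a) (LinearMap.ext fun v => by
        rw [LinearMap.comp_smul]
        exact hx (G.aug.lTensor A (a ⊗ₜ[R] v)))
    exact ⟨ρ, step 0 ρ (by rw [hρ]; rfl)⟩
  | succ n ih =>
    obtain ⟨ρ, ρ', hρ⟩ := ih
    refine ⟨ρ', step (n + 1) ρ' ?_⟩
    rw [eq_sub_of_add_eq hρ, LinearMap.sub_comp, LinearMap.comp_assoc, G.d_comp_d,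
      LinearMap.comp_zero, sub_zero]
    rfl

/-- Evaluate the homotopy formula at a basis vector `e` of degree `n + 1`. Both differentials next
to that degree have entries in `I`, so `x (a ⊗ e)` lies in `I (A ⊗ G)`, and the coordinate of `e`
recovers `x a`. -/
theorem mem_smul_top_of_smul_tensor_eq_zero {N : Type u} [AddCommGroup N] [Module R N]
    (G : MinimalFreeResolution R N) {A : Type u} [AddCommGroup A] [Module R A]
    (h : ∀ n, Function.Exact ((G.d (n + 1)).lTensor A) ((G.d n).lTensor A))
    {x : R} (hx : ∀ z : A ⊗[R] N, x • z = 0) {I : Ideal R} {n : ℕ}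
    (h₁ : LinearMap.range (G.d n) ≤ I • ⊤) (h₂ : LinearMap.range (G.d (n + 1)) ≤ I • ⊤)
    (hn : G.rank (n + 1) ≠ 0) (a : A) : x • a ∈ I • (⊤ : Submodule R A) := by
  obtain ⟨ρ, ρ', hρ⟩ := G.exists_homotopy h hx a n
  let i : Fin (G.rank (n + 1)) := ⟨0, Nat.pos_of_ne_zero hn⟩
  let e : Fin (G.rank (n + 1)) → R := Pi.single i 1
  have h3 : x • (a ⊗ₜ[R] e) ∈ I • (⊤ : Submodule R (A ⊗[R] (Fin (G.rank (n + 1)) → R))) := by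
    rw [show x • (a ⊗ₜ[R] e) = (G.d (n + 1)).lTensor A (ρ' e) + ρ (G.d n e) from
      (LinearMap.congr_fun hρ e).symm]
    refine add_mem (LinearMap.lTensor_mem_smul_top h₂ _) ?_
    have := Submodule.mem_map_of_mem (f := ρ) (h₁ ⟨e, rfl⟩)
    rw [Submodule.map_smul''] at this
    exact Submodule.smul_mono le_rfl le_top this
  have h4 := Submodule.mem_map_of_mem
    (f := (TensorProduct.rid R A).toLinearMap ∘ₗ (LinearMap.proj i).lTensor A) h3
  rw [Submodule.map_smul''] at h4
  have h5 := Submodule.smul_mono le_rfl le_top h4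
  simpa [e] using h5

/-! ### Vanishing and nonvanishing of syzygies, annihilation of tensor products -/

/-- Over an Artinian local ring, a module with a vanishing syzygy is free. -/
theorem free_of_rank_eq_zero [IsArtinianRing R] (F : MinimalFreeResolution R M) {i : ℕ}
    (hi : F.rank (i + 1) = 0) : Module.Free R M := by
  have hsub : Subsingleton (Fin (F.rank (i + 1)) → R) := by
    rw [hi]; infer_instance
  have hbot : LinearMap.range (F.d i) = ⊥ := by
    rw [LinearMap.range_eq_bot]
    exact LinearMap.ext fun x => by rw [Subsingleton.elim x 0, map_zero, map_zero]
  cases i with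
  | zero =>
    refine Module.Free.of_equiv (LinearEquiv.ofBijective F.aug ⟨?_, F.aug_surjective⟩)
    rw [← LinearMap.ker_eq_bot, ← F.exact_zero, hbot]
  | succ i =>
    refine F.free_of_rank_eq_zero (i := i) ?_
    by_contra hne
    -- A nonzero socle element of `R`, taken from the last nonzero power of `𝔪`. By minimality `d`
    -- kills `s` times a basis vector, so an injective `d` must have zero source.
    obtain ⟨s, hs0, hs⟩ : ∃ s : R, s ≠ 0 ∧ ∀ x ∈ IsLocalRing.maximalIdeal R, x * s = 0 := by
      obtain ⟨n, hn⟩ := IsArtinianRing.isNilpotent_jacobson_bot (R := R)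
      rw [IsLocalRing.jacobson_eq_maximalIdeal _ bot_ne_top] at hn
      have hex : ∃ n, IsLocalRing.maximalIdeal R ^ n = 0 := ⟨n, hn⟩
      classical
      have hpos : Nat.find hex ≠ 0 := by
        intro h0
        have := Nat.find_spec hex
        rw [h0, pow_zero] at this
        exact one_ne_zero this
      obtain ⟨m, hm⟩ := Nat.exists_eq_succ_of_ne_zero hpos
      have h1 : IsLocalRing.maximalIdeal R ^ m ≠ ⊥ := Nat.find_min hex (by omega)
      obtain ⟨s, hs, hs0⟩ := Submodule.exists_mem_ne_zero_of_ne_bot h1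
      refine ⟨s, hs0, fun x hx => ?_⟩
      have h2 := Ideal.mul_mem_mul hx hs
      have h3 := Nat.find_spec hex
      rw [hm, pow_succ'] at h3
      rw [h3] at h2
      exact h2
    let e : Fin (F.rank (i + 1)) → R := Pi.single ⟨0, Nat.pos_of_ne_zero hne⟩ s
    have he : e ≠ 0 := by
      intro h0
      exact hs0 (by simpa [e] using congrFun h0 ⟨0, Nat.pos_of_ne_zero hne⟩)
    have hker : LinearMap.ker (F.d i) = ⊥ := by rw [← F.exact_succ, hbot]
    refine he (LinearMap.ker_eq_bot'.1 hker e ?_)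
    have hes : e = s • Pi.single ⟨0, Nat.pos_of_ne_zero hne⟩ (1 : R) := by
      rw [← Pi.single_smul', smul_eq_mul, mul_one]
    rw [hes, map_smul]
    have hmem := F.minimal i ⟨Pi.single ⟨0, Nat.pos_of_ne_zero hne⟩ (1 : R), rfl⟩
    refine Submodule.smul_induction_on hmem (fun r hr v _ => ?_) (fun v w hv hw => ?_)
    · rw [smul_smul, mul_comm, hs r hr, zero_smul]
    · rw [smul_add, hv, hw, add_zero]

end MinimalFreeResolution

theorem smul_tmul_eq_zero_of_mem_smul {R P N : Type*} [CommRing R] [AddCommGroup P]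
    [AddCommGroup N] [Module R P] [Module R N] {J : Ideal R} {x : R}
    (h : ∀ r ∈ J, ∀ n : N, x • r • n = 0) {p : P} (hp : p ∈ J • (⊤ : Submodule R P)) (n : N) :
    x • (p ⊗ₜ[R] n) = 0 := by
  refine Submodule.smul_induction_on hp (fun r hr q _ => ?_) (fun p q hp hq => ?_)
  · rw [TensorProduct.smul_tmul, ← TensorProduct.tmul_smul, h r hr, TensorProduct.tmul_zero]
  · rw [TensorProduct.add_tmul, smul_add, hp, hq, add_zero]

/-- If `x J N = 0` and the submodule `S ≤ J P` stays a submodule after tensoring with `N`, then `x`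
kills `S ⊗ N`. -/
theorem Submodule.smul_tensor_eq_zero {R P N : Type*} [CommRing R] [AddCommGroup P]
    [AddCommGroup N] [Module R P] [Module R N] {J : Ideal R} {x : R}
    (h : ∀ r ∈ J, ∀ n : N, x • r • n = 0) {S : Submodule R P} (hS : S ≤ J • ⊤)
    (hinj : Function.Injective (S.subtype.rTensor N)) (z : S ⊗[R] N) : x • z = 0 := by
  refine hinj ?_
  rw [map_smul, map_zero]
  induction z with
  | zero => simp
  | add y z hy hz => rw [map_add, smul_add, hy, hz, add_zero]
  | tmul s n => exact smul_tmul_eq_zero_of_mem_smul h (hS s.2) n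

namespace MinimalFreeResolution

variable {R : Type u} [CommRing R] [IsLocalRing R] {M : Type u} [AddCommGroup M] [Module R M]

/-- If `d i` were zero, `d (i + 1)` would be onto a nonzero free module, against minimality and
Nakayama. -/
theorem range_d_ne_bot (F : MinimalFreeResolution R M) {i : ℕ} (hi : F.rank (i + 1) ≠ 0) :
    LinearMap.range (F.d i) ≠ ⊥ := by
  intro h
  have hker : LinearMap.ker (F.d i) = ⊤ := by
    rw [LinearMap.range_eq_bot] at h
    rw [h, LinearMap.ker_zero]
  have hle := F.minimal (i + 1)
  rw [F.exact_succ, hker] at hle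
  have : Nonempty (Fin (F.rank (i + 1))) := ⟨⟨0, Nat.pos_of_ne_zero hi⟩⟩
  exact top_ne_bot (Submodule.eq_bot_of_le_smul_of_le_jacobson_bot (IsLocalRing.maximalIdeal R)
    (⊤ : Submodule R (Fin (F.rank (i + 1)) → R)) Module.Finite.fg_top hle
    (IsLocalRing.maximalIdeal_le_jacobson _))

theorem range_d_succ_le [IsNoetherianRing R] (F : MinimalFreeResolution R M) {I : Ideal R} {i : ℕ}
    (hi : IFree I (LinearMap.range (F.d i))) : LinearMap.range (F.d (i + 1)) ≤ I • ⊤ := by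
  have h := hi.ker_le (F.d i).surjective_rangeRestrict (by
    rw [LinearMap.ker_rangeRestrict, ← F.exact_succ]
    exact F.minimal (i + 1))
  rwa [LinearMap.ker_rangeRestrict, ← F.exact_succ] at h

end MinimalFreeResolution

/-! ### The contradiction `I = 𝔪` -/

open IsLocalRing in
/-- If `𝔪 I N = 0`, the high syzygies of `M` and `N` are `I`-free and `M ⊗ G` is exact in high
degrees for a minimal free resolution `G` of `N`, then `M` or `N` is free. -/
theorem free_or_free_of_exact_of_IFree {R : Type u} [CommRing R] [IsLocalRing R]
    [IsArtinianRing R] {I : Ideal R} (hI : I ≠ maximalIdeal R)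
    {M N : Type u} [AddCommGroup M] [Module R M] [AddCommGroup N] [Module R N]
    (hN : maximalIdeal R • I • (⊤ : Submodule R N) = ⊥)
    (F : MinimalFreeResolution R M) (G : MinimalFreeResolution R N) {n₀ : ℕ}
    (hF : ∀ n, n₀ ≤ n → IFree I (LinearMap.range (F.d n)))
    (hG : ∀ n, n₀ ≤ n → IFree I (LinearMap.range (G.d n)))
    (h : ∀ n, n₀ ≤ n → Function.Exact ((G.d (n + 1)).lTensor M) ((G.d n).lTensor M)) :
    Module.Free R M ∨ Module.Free R N := by
  by_contra! hfree
  have hrF : ∀ i, F.rank (i + 1) ≠ 0 := fun i hi => hfree.1 (F.free_of_rank_eq_zero hi)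
  have hrG : ∀ i, G.rank (i + 1) ≠ 0 := fun i hi => hfree.2 (G.free_of_rank_eq_zero hi)
  have hNz : ∀ x ∈ maximalIdeal R, ∀ r ∈ I, ∀ n : N, x • r • n = 0 := by
    intro x hx r hr n
    rw [← Submodule.mem_bot R, ← hN]
    exact Submodule.smul_mem_smul hx (Submodule.smul_mem_smul hr trivial)
  have hinj : Function.Injective ((LinearMap.range (F.d (n₀ + 1))).subtype.rTensor N) :=
    G.rTensor_injective_of_exact (Submodule.subtype_injective _)
      (F.d n₀).surjective_rangeRestrict (F.exact_subtype_rangeRestrict n₀)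
      (F.exact_lTensor_range G h n₀ 0 (by omega))
  have hS : ∀ n, Function.Exact
      ((G.d (n + 1)).lTensor (LinearMap.range (F.d (n₀ + 1))))
      ((G.d n).lTensor (LinearMap.range (F.d (n₀ + 1)))) :=
    fun n => F.exact_lTensor_range G h (n₀ + 1) n (by omega)
  have hne : Nontrivial (LinearMap.range (F.d (n₀ + 1))) :=
    Submodule.nontrivial_iff_ne_bot.2 (F.range_d_ne_bot (hrF _))
  by_cases hI1 : I = ⊤
  -- Here `𝔪 N = 0`, so `S ⊗ N = 0`: the argument runs with `x = 1` and needs only minimality.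
  · have hx := Submodule.smul_tensor_eq_zero (J := maximalIdeal R) (x := 1) (N := N)
      (fun r hr n => by
        have := hNz r hr 1 (by simp [hI1]) n
        rwa [one_smul] at this ⊢) (F.minimal (n₀ + 1)) hinj
    refine top_ne_bot (Submodule.eq_bot_of_le_smul_of_le_jacobson_bot (maximalIdeal R)
      (⊤ : Submodule R (LinearMap.range (F.d (n₀ + 1)))) Module.Finite.fg_top (fun a _ => ?_)
      (maximalIdeal_le_jacobson _))
    simpa using G.mem_smul_top_of_smul_tensor_eq_zero hS hx (G.minimal 0) (G.minimal 1) (hrG 0) a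
  · obtain ⟨s, hs⟩ := (hF (n₀ + 1) (by omega)).exists_smul_mem_imp hI1
    refine hI ((maximalIdeal.isMaximal R).eq_of_le hI1 fun x hx => hs x ?_).symm
    exact G.mem_smul_top_of_smul_tensor_eq_zero hS
      (Submodule.smul_tensor_eq_zero (hNz x hx) (F.range_d_succ_le (hF n₀ le_rfl)) hinj)
      (G.range_d_succ_le (hG n₀ le_rfl)) (G.range_d_succ_le (hG (n₀ + 1) (by omega))) (hrG _) s

theorem mainTheorem8 {R : Type u} [CommRing R] [IsLocalRing R] [IsArtinianRing R]
    (ω : Type u) [AddCommGroup ω] [Module R ω] (hω : IsCanonicalModule R ω)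
    (I : Ideal R) (hI : I ≠ IsLocalRing.maximalIdeal R)
    (M : Type u) [AddCommGroup M] [Module R M] [Module.Finite R M]
    (hsoc : socle R M = I • (⊤ : Submodule R M))
    (hsoc' : socle R (M →ₗ[R] ω) = I • (⊤ : Submodule R (M →ₗ[R] ω)))
    (hann : IsLocalRing.maximalIdeal R • I • (⊤ : Submodule R M) = ⊥)
    (hann' : IsLocalRing.maximalIdeal R • I • (⊤ : Submodule R (M →ₗ[R] ω)) = ⊥)
    (F : MinimalFreeResolution R M) (F' : MinimalFreeResolution R (M →ₗ[R] ω))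
    (hF : ∀ᶠ i : ℕ in atTop, IFree I (F.syzygy i))
    (hF' : ∀ᶠ i : ℕ in atTop, IFree I (F'.syzygy i))
    (hTor : ∀ᶠ i : ℕ in atTop, Limits.IsZero
      (((Tor (ModuleCat.{u} R) i).obj (ModuleCat.of R M)).obj (ModuleCat.of R (M →ₗ[R] ω)))) :
    Module.Free R M ∨ Module.Free R (M →ₗ[R] ω) := by
  -- The range of `d n` is the syzygy of index `n + 1`, hence the shift by one in all three
  -- hypotheses.
  obtain ⟨n₀, h⟩ := eventually_atTop.1 ((hF.and hF').and hTor)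
  exact free_or_free_of_exact_of_IFree hI hann' F F' (n₀ := n₀)
    (fun n hn => (h (n + 1) (by omega)).1.1) (fun n hn => (h (n + 1) (by omega)).1.2)
    (fun n hn => F'.exact_lTensor_of_isZero_tor M n (h (n + 1) (by omega)).2)
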